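/- Let $n\ge 0$ be an integer and let $M$ be a smooth manifold of dimension $2n+1$. Let $(\phi,\xi,\eta,g)$ be a Kenmotsu structure on $M$, that is: $g$ is a Riemannian metric, $\phi$ a smooth $(1,1)$-tensor field, $\xi$ a smooth vector field and $\eta$ a smooth $1$-form with $$\phi^2=-I+\eta\otimes\xi,\qquad \eta(\xi)=1,\qquad \eta=g(\xi,\cdot),\qquad g(\phi\,\cdot,\phi\,\cdot)=g-\eta\otimes\eta,$$ and the Levi-Civita connection $\nabla$ of $g$ satisfies $(\nabla_X\phi)Y=g(\phi X,Y)\xi-\eta(Y)\phi X$ for all vector fields $X,Y$. Let $a>0$ be a real constant and let $$\overline{\phi}=\phi,\qquad \overline{\xi}=\tfrac1a\xi,\qquad \overline{\eta}=a\eta,\qquad \overline{g}=a\,g+a(a-1)\,\eta\otimes\eta$$ be the $D$-homothetically deformed structure. Let $V$ be a smooth vector field and $\overline{\lambda}$ a smooth function on $M$ such that $(V,\overline{\lambda})$ is an almost Ricci soliton for $\overline{g}$, i.e. $\frac12\pounds_V\overline{g}+\overline{\mathrm{Ric}}=\overline{\lambda}\,\overline{g}$, where $\overline{\mathrm{Ric}}$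 is the Ricci tensor of $\overline{g}$, and assume that $V$ is solenoidal, i.e. its divergence with respect to $\overline{g}$ vanishes. Then, with $\mathrm{Ric}$ and $\mathrm{scal}$ the Ricci tensor and the scalar curvature of $g$, $$\overline{\lambda}=\xi(\eta(V))-\frac{2n}{a^2},$$ $$\begin{aligned}\mathrm{Ric}(X,Y)={}&[a\,\xi(\eta(V))-2n]\,g(X,Y)+a(a-1)\,\xi(\eta(V))\,\eta(X)\eta(Y)-\frac a2\,[g(\nabla_XV,Y)+g(\nabla_YV,X)]\\&-\frac{a(a-1)}2\,\{\eta(X)[\eta(\nabla_YV)+g(Y,V)]+\eta(Y)[\eta(\nabla_XV)+g(X,V)]-2\eta(X)\eta(Y)\eta(V)\}\end{aligned}$$ for all $X,Y$, and $$\mathrm{scal}=(2n+1)\,[a\,\xi(\eta(V))-2n].$$ -/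

import Mathlib

open scoped ContDiff Manifold

theorem AlmostContact.contMDiffAt_smulRight {E : Type*} [NormedAddCommGroup E] [NormedSpace ℝ E]
    {H : Type*} [TopologicalSpace H] {I : ModelWithCorners ℝ E H}
    {M : Type*} [TopologicalSpace M] [ChartedSpace H M] {A B : M → (E →L[ℝ] ℝ)} {x : M}
    (hA : ContMDiffAt I 𝓘(ℝ, E →L[ℝ] ℝ) ∞ A x) (hB : ContMDiffAt I 𝓘(ℝ, E →L[ℝ] ℝ) ∞ B x) :
    ContMDiffAt I 𝓘(ℝ, E →L[ℝ] E →L[ℝ] ℝ) ∞ (fun y ↦ (A y).smulRight (B y)) x := by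
  have h : ContDiff ℝ ∞ (fun p : (E →L[ℝ] ℝ) × (E →L[ℝ] ℝ) ↦
      ContinuousLinearMap.smulRightL ℝ E (E →L[ℝ] ℝ) p.1 p.2) := by fun_prop
  exact h.contDiffAt.contMDiffAt.comp x (hA.prodMk_space hB)

noncomputable section

open Bundle VectorField FiberBundle
open scoped Topology

set_option linter.unusedSectionVars false

namespace AlmostContact

variable {E : Type*} [NormedAddCommGroup E] [NormedSpace ℝ E] [FiniteDimensional ℝ E]
  {H : Type*} [TopologicalSpace H] {I : ModelWithCorners ℝ E H}
  {M : Type*} [TopologicalSpace M] [ChartedSpace H M] [IsManifold I ∞ M]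

variable (I M) in
/-- Smooth Riemannian metrics on `M`. -/
abbrev RiemMetric := ContMDiffRiemannianMetric I ∞ E (TangentSpace I : M → Type _)

/-- The directional derivative `X(f)` of a function along a vector field. -/
def dirDeriv (X : Π x : M, TangentSpace I x) (f : M → ℝ) (x : M) : ℝ :=
  mvfderiv I f x (X x)

/-- The function `g(X, Y)`. -/
def pairing (g : RiemMetric I M) (X Y : Π x : M, TangentSpace I x) (x : M) : ℝ :=
  g.inner x (X x) (Y x)

/-! ### The Levi-Civita connection -/

/-- Half of the right-hand side of the Koszul formula, so that `g(∇_X Y, Z) = koszul g Y X Z`. -/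
def koszul (g : RiemMetric I M) (Y X Z : Π x : M, TangentSpace I x) (x : M) : ℝ :=
  (1 / 2) * (dirDeriv X (pairing g Y Z) x + dirDeriv Y (pairing g X Z) x
    - dirDeriv Z (pairing g X Y) x
    + g.inner x (mlieBracket I X Y x) (Z x)
    - g.inner x (mlieBracket I X Z x) (Y x)
    - g.inner x (mlieBracket I Y Z x) (X x))

theorem mdiffAt_pairing (g : RiemMetric I M) {X Y : Π x : M, TangentSpace I x} {x : M}
    (hX : MDiffAt (T% X) x) (hY : MDiffAt (T% Y) x) : MDiffAt (pairing g X Y) x := by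
  let _ : RiemannianBundle (TangentSpace I : M → Type _) := ⟨g.toRiemannianMetric⟩
  exact MDifferentiableAt.inner_bundle (E := (TangentSpace I : M → Type _)) (F := E)
    (IB := I) (b := id) hX hY

theorem dirDeriv_add (X : Π x : M, TangentSpace I x) {f f' : M → ℝ} {x : M}
    (hf : MDiffAt f x) (hf' : MDiffAt f' x) :
    dirDeriv X (f + f') x = dirDeriv X f x + dirDeriv X f' x := by
  simp [dirDeriv, mvfderiv_add hf hf']

theorem dirDeriv_mul (X : Π x : M, TangentSpace I x) {f f' : M → ℝ} {x : M}
    (hf : MDiffAt f x) (hf' : MDiffAt f' x) :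
    dirDeriv X (f * f') x = f x * dirDeriv X f' x + f' x * dirDeriv X f x := by
  simp [dirDeriv, mvfderiv_mul hf hf']

theorem pairing_add_left (g : RiemMetric I M) (X X' Y : Π x : M, TangentSpace I x) :
    pairing g (X + X') Y = pairing g X Y + pairing g X' Y := by
  ext x; simp [pairing]

theorem pairing_add_right (g : RiemMetric I M) (X Y Y' : Π x : M, TangentSpace I x) :
    pairing g X (Y + Y') = pairing g X Y + pairing g X Y' := by
  ext x; simp [pairing]

theorem pairing_smul_left (g : RiemMetric I M) (f : M → ℝ) (X Y : Π x : M, TangentSpace I x) :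
    pairing g (f • X) Y = f * pairing g X Y := by
  ext x; simp [pairing]

theorem pairing_smul_right (g : RiemMetric I M) (f : M → ℝ) (X Y : Π x : M, TangentSpace I x) :
    pairing g X (f • Y) = f * pairing g X Y := by
  ext x; simp [pairing]

theorem dirDeriv_add_left (X X' : Π x : M, TangentSpace I x) (f : M → ℝ) (x : M) :
    dirDeriv (X + X') f x = dirDeriv X f x + dirDeriv X' f x := by
  simp [dirDeriv]

theorem dirDeriv_smul_left (h : M → ℝ) (X : Π x : M, TangentSpace I x) (f : M → ℝ) (x : M) :
    dirDeriv (h • X) f x = h x * dirDeriv X f x := by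
  simp [dirDeriv]

theorem koszul_tensorial_left (g : RiemMetric I M) {Y Z : Π x : M, TangentSpace I x} {x : M}
    (hY : MDiffAt (T% Y) x) (hZ : MDiffAt (T% Z) x) :
    TensorialAt I E (fun X ↦ koszul g Y X Z x) x where
  smul {f X} hf hX := by
    simp only [koszul, pairing_smul_left, dirDeriv_smul_left,
      dirDeriv_mul _ hf (mdiffAt_pairing g hX hZ), dirDeriv_mul _ hf (mdiffAt_pairing g hX hY),
      mlieBracket_smul_left hf hX]
    simp [dirDeriv, pairing]
    rw [g.symm x (X x) (Z x), g.symm x (X x) (Y x), g.symm x (mlieBracket I Y Z x) (X x)]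
    ring
  add {X X'} hX hX' := by
    simp only [koszul, pairing_add_left, dirDeriv_add_left,
      dirDeriv_add _ (mdiffAt_pairing g hX hZ) (mdiffAt_pairing g hX' hZ),
      dirDeriv_add _ (mdiffAt_pairing g hX hY) (mdiffAt_pairing g hX' hY),
      mlieBracket_add_left hX hX']
    simp
    ring

theorem koszul_tensorial_right (g : RiemMetric I M) {Y X : Π x : M, TangentSpace I x} {x : M}
    (hY : MDiffAt (T% Y) x) (hX : MDiffAt (T% X) x) :
    TensorialAt I E (fun Z ↦ koszul g Y X Z x) x where
  smul {f Z} hf hZ := by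
    simp only [koszul, pairing_smul_right, dirDeriv_smul_left,
      dirDeriv_mul _ hf (mdiffAt_pairing g hY hZ), dirDeriv_mul _ hf (mdiffAt_pairing g hX hZ),
      mlieBracket_smul_right hf hZ]
    simp [dirDeriv, pairing]
    rw [g.symm x (Z x) (Y x), g.symm x (Z x) (X x)]
    ring
  add {Z Z'} hZ hZ' := by
    simp only [koszul, pairing_add_right, dirDeriv_add_left,
      dirDeriv_add _ (mdiffAt_pairing g hY hZ) (mdiffAt_pairing g hY hZ'),
      dirDeriv_add _ (mdiffAt_pairing g hX hZ) (mdiffAt_pairing g hX hZ'),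
      mlieBracket_add_right hZ hZ']
    simp
    ring

theorem koszul_smul (g : RiemMetric I M) {f : M → ℝ} {Y X Z : Π x : M, TangentSpace I x} {x : M}
    (hf : MDiffAt f x)
    (hY : MDiffAt (T% Y) x) (hX : MDiffAt (T% X) x) (hZ : MDiffAt (T% Z) x) :
    koszul g (f • Y) X Z x
      = f x * koszul g Y X Z x + dirDeriv X f x * g.inner x (Y x) (Z x) := by
  simp only [koszul, pairing_smul_left, pairing_smul_right, dirDeriv_smul_left,
    dirDeriv_mul _ hf (mdiffAt_pairing g hY hZ), dirDeriv_mul _ hf (mdiffAt_pairing g hX hY),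
    mlieBracket_smul_left hf hY, mlieBracket_smul_right hf hY]
  simp [dirDeriv, pairing]
  rw [g.symm x (X x) (Y x)]
  ring

theorem koszul_add (g : RiemMetric I M) {Y Y' X Z : Π x : M, TangentSpace I x} {x : M}
    (hY : MDiffAt (T% Y) x) (hY' : MDiffAt (T% Y') x)
    (hX : MDiffAt (T% X) x) (hZ : MDiffAt (T% Z) x) :
    koszul g (Y + Y') X Z x = koszul g Y X Z x + koszul g Y' X Z x := by
  simp only [koszul, pairing_add_left, pairing_add_right, dirDeriv_add_left,
    dirDeriv_add _ (mdiffAt_pairing g hY hZ) (mdiffAt_pairing g hY' hZ),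
    dirDeriv_add _ (mdiffAt_pairing g hX hY) (mdiffAt_pairing g hX hY'),
    mlieBracket_add_left hY hY', mlieBracket_add_right hY hY']
  simp
  ring

instance (x : M) : FiniteDimensional ℝ (TangentSpace I x) :=
  inferInstanceAs (FiniteDimensional ℝ E)

instance (x : M) : T2Space (TangentSpace I x) :=
  inferInstanceAs (T2Space E)

/-- The metric at a point as a bilinear form. -/
def metricForm (g : RiemMetric I M) (x : M) : LinearMap.BilinForm ℝ (TangentSpace I x) :=
  LinearMap.mk₂ ℝ (fun u v ↦ g.inner x u v) (by simp) (by simp) (by simp) (by simp)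

theorem metricForm_nondegenerate (g : RiemMetric I M) (x : M) : (metricForm g x).Nondegenerate := by
  constructor
  · intro u hu
    by_contra h
    exact (g.pos x u h).ne' (hu u)
  · intro u hu
    by_contra h
    exact (g.pos x u h).ne' (hu u)

/-- Koszul's form `(u, w) ↦ g(∇_u Y, w)` at a point where `Y` is differentiable. -/
def koszulHom (g : RiemMetric I M) {Y : Π x : M, TangentSpace I x} {x : M} (hY : MDiffAt (T% Y) x) :
    TangentSpace I x →L[ℝ] TangentSpace I x →L[ℝ] ℝ :=
  TensorialAt.mkHom₂ (fun X Z ↦ koszul g Y X Z x) x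
    (fun _ hZ ↦ koszul_tensorial_left g hY hZ) (fun _ hX ↦ koszul_tensorial_right g hY hX)

open Classical in
/-- The vector `∇_u Y`, characterized by `g(∇_u Y, w) = koszulHom g hY u w`
(with the value `0` if `Y` is not differentiable at the point). -/
def leviCivitaFun (g : RiemMetric I M) (Y : Π x : M, TangentSpace I x) (x : M) :
    TangentSpace I x →L[ℝ] TangentSpace I x :=
  if hY : MDiffAt (T% Y) x then
    LinearMap.toContinuousLinearMap
      (((metricForm g x).toDual (metricForm_nondegenerate g x)).symm.toLinearMap ∘ₗ
        (ContinuousLinearMap.coeLM ℝ ∘ₗ (koszulHom g hY).toLinearMap))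
  else 0

theorem inner_leviCivitaFun (g : RiemMetric I M) {X Y Z : Π x : M, TangentSpace I x} {x : M}
    (hX : MDiffAt (T% X) x) (hY : MDiffAt (T% Y) x) (hZ : MDiffAt (T% Z) x) :
    g.inner x (leviCivitaFun g Y x (X x)) (Z x) = koszul g Y X Z x := by
  have h := LinearMap.BilinForm.apply_toDual_symm_apply (hB := metricForm_nondegenerate g x)
    (f := ((koszulHom g hY (X x) : TangentSpace I x →L[ℝ] ℝ) : TangentSpace I x →ₗ[ℝ] ℝ)) (Z x)
  have h2 : koszulHom g hY (X x) (Z x) = koszul g Y X Z x :=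
    TensorialAt.mkHom₂_apply (Φ := fun X Z ↦ koszul g Y X Z x) _ _ hX hZ
  rw [leviCivitaFun, dif_pos hY, ← h2]
  exact h

theorem inner_ext (g : RiemMetric I M) {x : M} {u v : TangentSpace I x}
    (h : ∀ w, g.inner x u w = g.inner x v w) : u = v := by
  by_contra hne
  have := g.pos x (u - v) (sub_ne_zero.2 hne)
  simp [h] at this

/-- The Levi-Civita connection of a Riemannian metric; `leviCivita g Y x u` is `∇_u Y`. -/
def leviCivita (g : RiemMetric I M) : CovariantDerivative I E (TangentSpace I : M → Type _) where
  toFun := leviCivitaFun g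
  isCovariantDerivativeOnUniv :=
    { add := by
        intro Y Y' x hY hY' _
        ext u
        refine inner_ext g fun w ↦ ?_
        have hu := mdifferentiableAt_extend I E u
        have hw := mdifferentiableAt_extend I E w
        have h1 := inner_leviCivitaFun g hu (mdifferentiableAt_add_section hY hY') hw
        have h2 := inner_leviCivitaFun g hu hY hw
        have h3 := inner_leviCivitaFun g hu hY' hw
        have h4 := koszul_add g hY hY' hu hw
        simp only [extend_apply_self] at h1 h2 h3
        simp [h2, h3, ← h4, ← h1]
      leibniz := by
        intro Y f x hY hf _
        ext u
        refine inner_ext g fun w ↦ ?_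
        have hu := mdifferentiableAt_extend I E u
        have hw := mdifferentiableAt_extend I E w
        have h1 := inner_leviCivitaFun g hu (hf.smul_section hY) hw
        have h2 := inner_leviCivitaFun g hu hY hw
        have h4 := koszul_smul g hf hY hu hw
        simp only [extend_apply_self, dirDeriv] at h1 h2 h4
        simp [h2]
        rw [← h4]
        exact h1 }

theorem inner_leviCivita (g : RiemMetric I M) {X Y Z : Π x : M, TangentSpace I x} {x : M}
    (hX : MDiffAt (T% X) x) (hY : MDiffAt (T% Y) x) (hZ : MDiffAt (T% Z) x) :
    g.inner x (leviCivita g Y x (X x)) (Z x) = koszul g Y X Z x :=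
  inner_leviCivitaFun g hX hY hZ

theorem leviCivita_torsion_free (g : RiemMetric I M) {X Y : Π x : M, TangentSpace I x} {x : M}
    (hX : MDiffAt (T% X) x) (hY : MDiffAt (T% Y) x) :
    leviCivita g Y x (X x) - leviCivita g X x (Y x) = mlieBracket I X Y x := by
  refine inner_ext g fun w ↦ ?_
  have hw := mdifferentiableAt_extend I E w
  have h1 := inner_leviCivita g hX hY hw
  have h2 := inner_leviCivita g hY hX hw
  simp only [extend_apply_self] at h1 h2
  have hs : pairing g Y X = pairing g X Y := by ext y; exact g.symm y _ _
  simp [h1, h2, koszul, hs, mlieBracket_swap_apply (V := Y) (W := X)]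
  ring

theorem leviCivita_metric (g : RiemMetric I M) {X Y Z : Π x : M, TangentSpace I x} {x : M}
    (hX : MDiffAt (T% X) x) (hY : MDiffAt (T% Y) x) (hZ : MDiffAt (T% Z) x) :
    dirDeriv X (pairing g Y Z) x
      = g.inner x (leviCivita g Y x (X x)) (Z x) + g.inner x (Y x) (leviCivita g Z x (X x)) := by
  have hs : pairing g Z Y = pairing g Y Z := by ext y; exact g.symm y _ _
  rw [g.symm x (Y x), inner_leviCivita g hX hY hZ, inner_leviCivita g hX hZ hY]
  simp [koszul, hs, mlieBracket_swap_apply (V := Z) (W := Y)]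
  ring

/-! ### Curvature, divergence, Lie derivative of the metric -/

/-- `R(X,Y)Z = ∇_X ∇_Y Z - ∇_Y ∇_X Z - ∇_{[X,Y]} Z`. -/
def curvature (g : RiemMetric I M) (X Y Z : Π x : M, TangentSpace I x) (x : M) : TangentSpace I x :=
  leviCivita g (fun y ↦ leviCivita g Z y (Y y)) x (X x)
    - leviCivita g (fun y ↦ leviCivita g Z y (X y)) x (Y x)
    - leviCivita g Z x (mlieBracket I X Y x)

/-- The Ricci tensor: `Ric(u,v)` is the trace of `w ↦ R(w,u)v`, computed in a basis of the tangent
space. Tangent vectors are extended to vector fields that are smooth near the point; the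
curvature does not depend on the extensions. -/
def ricci (g : RiemMetric I M) (x : M) (u v : TangentSpace I x) : ℝ :=
  ∑ i, (Module.finBasis ℝ (TangentSpace I x)).coord i
    (curvature g (extend E (Module.finBasis ℝ (TangentSpace I x) i)) (extend E u) (extend E v) x)

/-- An orthonormal basis of the tangent space at a point. -/
def onb (g : RiemMetric I M) (x : M) :
    Fin (Module.finrank ℝ (TangentSpace I x)) → TangentSpace I x :=
  letI : RiemannianBundle (TangentSpace I : M → Type _) := ⟨g.toRiemannianMetric⟩
  stdOrthonormalBasis ℝ (TangentSpace I x)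

theorem inner_onb (g : RiemMetric I M) (x : M) (i j : Fin (Module.finrank ℝ (TangentSpace I x))) :
    g.inner x (onb g x i) (onb g x j) = if i = j then 1 else 0 := by
  let _ : RiemannianBundle (TangentSpace I : M → Type _) := ⟨g.toRiemannianMetric⟩
  exact orthonormal_iff_ite.1 (stdOrthonormalBasis ℝ (TangentSpace I x)).orthonormal i j

/-- The scalar curvature, i.e. the trace of the Ricci tensor with respect to the metric. -/
def scal (g : RiemMetric I M) (x : M) : ℝ := ∑ i, ricci g x (onb g x i) (onb g x i)

/-- The divergence of a vector field: the trace of `u ↦ ∇_u V`. -/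
def divergence (g : RiemMetric I M) (V : Π x : M, TangentSpace I x) (x : M) : ℝ :=
  LinearMap.trace ℝ (TangentSpace I x) (leviCivita g V x)

/-- `(£_V g)(X,Y) = V(g(X,Y)) - g([V,X],Y) - g(X,[V,Y])`. -/
def lieDerivMetric (g : RiemMetric I M) (V X Y : Π x : M, TangentSpace I x) (x : M) : ℝ :=
  dirDeriv V (pairing g X Y) x
    - g.inner x (mlieBracket I V X x) (Y x) - g.inner x (X x) (mlieBracket I V Y x)

/-- `(V, lam)` is an almost Ricci soliton for `g`: `V` is a smooth vector field, `lam` a smooth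
function, and `½ £_V g + Ric = lam g`. -/
structure IsAlmostRicciSoliton (g : RiemMetric I M) (V : Π x : M, TangentSpace I x) (lam : M → ℝ) :
    Prop where
  smooth_field : CMDiff ∞ (T% V)
  smooth_fun : CMDiff ∞ lam
  equation : ∀ (x : M) (X Y : Π x : M, TangentSpace I x),
    CMDiffAt ∞ (T% X) x → CMDiffAt ∞ (T% Y) x →
      (1 / 2) * lieDerivMetric g V X Y x + ricci g x (X x) (Y x) = lam x * g.inner x (X x) (Y x)

/-! ### Almost contact metric structures -/

variable (I M) in
/-- An almost contact metric structure `(φ, ξ, η, g)`. -/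
structure AlmostContactMetric where
  /-- The Riemannian metric. -/
  g : RiemMetric I M
  /-- The (1,1)-tensor field. -/
  φ : Π x : M, TangentSpace I x →L[ℝ] TangentSpace I x
  /-- The Reeb vector field. -/
  ξ : Π x : M, TangentSpace I x
  /-- The 1-form. -/
  η : Π x : M, TangentSpace I x →L[ℝ] ℝ
  smooth_φ : ContMDiff I (I.prod 𝓘(ℝ, E →L[ℝ] E)) ∞
    (fun x ↦ TotalSpace.mk' (E →L[ℝ] E) (E := fun x : M ↦ TangentSpace I x →L[ℝ] TangentSpace I x)
      x (φ x))
  smooth_ξ : CMDiff ∞ (T% ξ)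
  smooth_η : ContMDiff I (I.prod 𝓘(ℝ, E →L[ℝ] ℝ)) ∞
    (fun x ↦ TotalSpace.mk' (E →L[ℝ] ℝ) (E := fun x : M ↦ TangentSpace I x →L[ℝ] ℝ) x (η x))
  φ_sq : ∀ (x : M) (v : TangentSpace I x), φ x (φ x v) = -v + η x v • ξ x
  η_ξ : ∀ x : M, η x (ξ x) = 1
  η_eq : ∀ (x : M) (v : TangentSpace I x), η x v = g.inner x (ξ x) v
  compat : ∀ (x : M) (u v : TangentSpace I x),
    g.inner x (φ x u) (φ x v) = g.inner x u v - η x u * η x v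

/-- The Kenmotsu condition `(∇_u φ) Y = g(φ u, Y) ξ - η(Y) φ u`, where
`(∇_u φ) Y = ∇_u (φ Y) - φ (∇_u Y)`. -/
def AlmostContactMetric.IsKenmotsu (S : AlmostContactMetric I M) : Prop :=
  ∀ Y : Π x : M, TangentSpace I x, CMDiff ∞ (T% Y) → ∀ (x : M) (u : TangentSpace I x),
    leviCivita S.g (fun y ↦ S.φ y (Y y)) x u - S.φ x (leviCivita S.g Y x u)
      = S.g.inner x (S.φ x u) (Y x) • S.ξ x - S.η x (Y x) • S.φ x u

/-- The form `η ⊗ η`. -/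
def AlmostContactMetric.etaSq (S : AlmostContactMetric I M) (x : M) :
    TangentSpace I x →L[ℝ] TangentSpace I x →L[ℝ] ℝ :=
  (S.η x).smulRight (S.η x)

theorem AlmostContactMetric.η_φ (S : AlmostContactMetric I M) (x : M) (v : TangentSpace I x) :
    S.η x (S.φ x v) = 0 := by
  have h0 : S.φ x (S.ξ x) = 0 := by
    by_contra h
    have h1 := S.g.pos x _ h
    rw [S.compat, ← S.η_eq, S.η_ξ] at h1
    simp at h1
  have h1 := congrArg (S.φ x) (S.φ_sq x v)
  rw [S.φ_sq x (S.φ x v), map_add, map_neg, map_smul, h0] at h1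
  simpa [S.η_ξ] using congrArg (S.η x) h1

theorem AlmostContactMetric.η_sq_le (S : AlmostContactMetric I M) (x : M)
    (v : TangentSpace I x) : S.η x v * S.η x v ≤ S.g.inner x v v := by
  have h := S.compat x v v
  rcases eq_or_ne (S.φ x v) 0 with h0 | h0
  · simp [h0] at h; linarith
  · have := S.g.pos x _ h0; linarith

set_option synthInstance.maxHeartbeats 400000 in
theorem AlmostContactMetric.smooth_etaSq (S : AlmostContactMetric I M) :
    ContMDiff I (I.prod 𝓘(ℝ, E →L[ℝ] E →L[ℝ] ℝ)) ∞
      (fun x ↦ TotalSpace.mk' (E →L[ℝ] E →L[ℝ] ℝ)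
        (E := fun x : M ↦ TangentSpace I x →L[ℝ] TangentSpace I x →L[ℝ] ℝ) x (S.etaSq x)) := by
  intro x
  have h := S.smooth_η x
  rw [contMDiffAt_hom_bundle] at h ⊢
  refine ⟨contMDiffAt_id, ?_⟩
  have h2 := S.smooth_η x
  rw [contMDiffAt_section] at h2
  have h3 := contMDiffAt_smulRight h.2 h2
  refine h3.congr_of_eventuallyEq ?_
  have hmem := (trivializationAt (E →L[ℝ] ℝ)
    (fun x : M ↦ TangentSpace I x →L[ℝ] ℝ) x).open_baseSet.mem_nhds
      (mem_baseSet_trivializationAt (E →L[ℝ] ℝ) (fun x : M ↦ TangentSpace I x →L[ℝ] ℝ) x)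
  filter_upwards [hmem] with y hy
  ext v w
  simp [ContinuousLinearMap.inCoordinates, AlmostContactMetric.etaSq,
    Bundle.Trivialization.continuousLinearMapAt_apply, Trivialization.linearMapAt_apply]
  left
  exact congrArg (fun L : E →L[ℝ] ℝ ↦ L w) (if_pos hy)

set_option synthInstance.maxHeartbeats 400000 in
/-- The deformed metric `a g + a (a - 1) η ⊗ η`. -/
def AlmostContactMetric.deformMetric (S : AlmostContactMetric I M) (a : ℝ) (ha : 0 < a) :
    RiemMetric I M where
  inner x := a • S.g.inner x + (a * (a - 1)) • S.etaSq x
  symm x v w := by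
    simp [AlmostContactMetric.etaSq, S.g.symm x v w, mul_comm (S.η x v)]
  pos x v hv := by
    have h1 := S.η_sq_le x v
    have h2 := S.g.pos x v hv
    simp only [AlmostContactMetric.etaSq, add_apply,
      smul_apply, ContinuousLinearMap.smulRight_apply, smul_eq_mul]
    rcases (mul_self_nonneg (S.η x v)).eq_or_lt with h | h
    · rw [← h]; simp; positivity
    · nlinarith [mul_pos (mul_pos ha ha) h, mul_nonneg ha.le (sub_nonneg.2 h1)]
  isVonNBounded x := by
    set c : ℝ := min a (a * a) with hc
    have hc0 : 0 < c := lt_min ha (mul_pos ha ha)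
    have hs : 0 < Real.sqrt c := Real.sqrt_pos.2 hc0
    have hb := (S.g.isVonNBounded x).image
      ((Real.sqrt c)⁻¹ • ContinuousLinearMap.id ℝ (TangentSpace I x))
    refine hb.subset ?_
    intro v hv
    refine ⟨Real.sqrt c • v, ?_, ?_⟩
    · have h1 := S.η_sq_le x v
      have h2 := mul_self_nonneg (S.η x v)
      have h3 : c ≤ a := min_le_left _ _
      have h4 : c ≤ a * a := min_le_right _ _
      simp only [AlmostContactMetric.etaSq, add_apply, Set.mem_ofPred_eq,
        smul_apply, ContinuousLinearMap.smulRight_apply, smul_eq_mul] at hv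
      simp only [Set.mem_ofPred_eq, map_smul, smul_apply, smul_eq_mul]
      rw [← mul_assoc, Real.mul_self_sqrt hc0.le]
      nlinarith [mul_le_mul_of_nonneg_right h3 (sub_nonneg.2 h1),
        mul_le_mul_of_nonneg_right h4 h2]
    · simp [smul_smul, hs.ne']
  contMDiff := by
    have h1 := S.g.contMDiff.const_smul_section (a := a)
    have h2 := S.smooth_etaSq.const_smul_section (a := a * (a - 1))
    exact h1.add_section h2

/-- The `D`-homothetic deformation
`(φ, a⁻¹ ξ, a η, a g + a (a - 1) η ⊗ η)` of an almost contact metric structure. -/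
def AlmostContactMetric.deform (S : AlmostContactMetric I M) (a : ℝ) (ha : 0 < a) :
    AlmostContactMetric I M where
  g := S.deformMetric a ha
  φ := S.φ
  ξ := fun x ↦ (1 / a) • S.ξ x
  η := fun x ↦ a • S.η x
  smooth_φ := S.smooth_φ
  smooth_ξ := S.smooth_ξ.const_smul_section (a := 1 / a)
  smooth_η := S.smooth_η.const_smul_section (a := a)
  φ_sq x v := by
    rw [S.φ_sq]
    simp [smul_smul]
    field_simp
  η_ξ x := by
    simp [S.η_ξ]
    field_simp
  η_eq x v := by
    simp [AlmostContactMetric.deformMetric, AlmostContactMetric.etaSq, S.η_ξ, ← S.η_eq]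
    field_simp
    ring
  compat x u v := by
    simp [AlmostContactMetric.deformMetric, AlmostContactMetric.etaSq, S.η_φ, S.compat]
    ring

end AlmostContact

end

open AlmostContact

namespace AlmostContact

open Bundle VectorField FiberBundle
open scoped Topology

set_option linter.unusedSectionVars false

variable {E : Type*} [NormedAddCommGroup E] [NormedSpace ℝ E] [FiniteDimensional ℝ E]
  {H : Type*} [TopologicalSpace H] {I : ModelWithCorners ℝ E H}
  {M : Type*} [TopologicalSpace M] [ChartedSpace H M] [IsManifold I ∞ M]

/-! Write `h = g - η ⊗ η`. The Kenmotsu condition gives `∇_u ξ = u - η(u) ξ`, so `(∇_u η)(Y) = h(u,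
Y)` is symmetric and Koszul's formula shows that the deformation changes the connection only by `(1
- 1/a) h(u, Y) ξ`. Differentiating once more, the curvature changes by `(1 - 1/a) (h(Y, Z) X - h(X,
Z) Y)` and the Ricci tensor by `(dim - 1) (1 - 1/a) h` (`leviCivita_deform`, `curvature_deform`,
`ricci_deform`).

Since `h(ξ, ·) = 0`, the soliton equation at `(ξ, ξ)` involves only `Ric(ξ, ξ) = 1 - dim`, which
follows from `R(X, Y) ξ = η(X) Y - η(Y) X`; this determines the soliton function. Substituting it
back, the identity `g = a⁻² ḡ + (1 - 1/a) h` collapses the constant terms to `-(dim - 1) g`, which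
gives `Ric`. In the trace the `ξ(η(V))` terms carrying `a (a - 1)` cancel, and the remaining term is
`div V`, which the deformation does not change (`divergence_deform`).

Iterated covariant derivatives must be known to be smooth, because the connection is set to `0` at
points where a field is not differentiable. Also, `ricci` uses arbitrary extensions of vectors, so
inserting the field `ξ` needs tensoriality of the curvature in its last argument
(`curvature_eq_of_eq`). -/

/-! ### Smoothness of pairings, brackets and covariant derivatives. -/

theorem mdiffAt_of_smooth {X : Π x : M, TangentSpace I x} {x : M} (hX : CMDiffAt ∞ (T% X) x) :
    MDiffAt (T% X) x :=
  hX.mdifferentiableAt (by simp)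

theorem eventually_mdiffAt {X : Π x : M, TangentSpace I x} {x : M} (hX : CMDiffAt ∞ (T% X) x) :
    ∀ᶠ y in 𝓝 x, MDiffAt (T% X) y := by
  have h1 : CMDiffAt 1 (T% X) x := hX.of_le (by exact_mod_cast le_top)
  exact ((contMDiffAt_iff_contMDiffAt_nhds (by simp)).1 h1).mono fun y hy ↦
    hy.mdifferentiableAt one_ne_zero

theorem eventually_mdiffAt_fun {f : M → ℝ} {x : M} (hf : CMDiffAt ∞ f x) :
    ∀ᶠ y in 𝓝 x, MDiffAt f y := by
  have h1 : CMDiffAt 1 f x := hf.of_le (by exact_mod_cast le_top)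
  exact ((contMDiffAt_iff_contMDiffAt_nhds (by simp)).1 h1).mono fun y hy ↦
    hy.mdifferentiableAt one_ne_zero

theorem contMDiffAt_pairing (g : RiemMetric I M) {X Y : Π x : M, TangentSpace I x} {x : M}
    (hX : CMDiffAt ∞ (T% X) x) (hY : CMDiffAt ∞ (T% Y) x) : CMDiffAt ∞ (pairing g X Y) x := by
  let _ : RiemannianBundle (TangentSpace I : M → Type _) := ⟨g.toRiemannianMetric⟩
  exact ContMDiffAt.inner_bundle (E := (TangentSpace I : M → Type _)) (F := E)
    (IB := I) (b := id) hX hY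

theorem contMDiffAt_dirDeriv {X : Π x : M, TangentSpace I x} {f : M → ℝ} {x : M}
    (hX : CMDiffAt ∞ (T% X) x) (hf : CMDiffAt ∞ f x) : CMDiffAt ∞ (dirDeriv X f) x := by
  have h1 := ContMDiffAt.mfderiv_const (m := ∞) hf (by simp)
  have h2 := ContMDiffAt.clm_apply_of_inCoordinates (b₁ := id) (b₂ := f) h1 hX hf
  exact (contMDiff_snd_tangentBundle_modelSpace ℝ 𝓘(ℝ, ℝ)).contMDiffAt.comp x h2

theorem contMDiffAt_mlieBracket {X Y : Π x : M, TangentSpace I x} {x : M}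
    (hX : CMDiffAt ∞ (T% X) x) (hY : CMDiffAt ∞ (T% Y) x) :
    CMDiffAt ∞ (T% (mlieBracket I X Y)) x :=
  have : IsManifold I (minSmoothness ℝ 2) M :=
    IsManifold.of_le (n := ∞) 
      (by rw [minSmoothness_of_isRCLikeNormedField]
          exact WithTop.coe_le_coe.2 (le_top : (2 : ℕ∞) ≤ ⊤))
  -- The bracket loses one derivative, which is harmless because `∞ + 1` is `∞`.
  have : IsManifold I ((⊤ : ℕ∞) + 1) M := inferInstanceAs (IsManifold I ∞ M)
  ContMDiffAt.mlieBracket_vectorField (n := ⊤) (m := ⊤) hX hY (by simp)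

theorem contMDiffAt_koszul (g : RiemMetric I M) {X Y Z : Π x : M, TangentSpace I x} {x : M}
    (hY : CMDiffAt ∞ (T% Y) x) (hX : CMDiffAt ∞ (T% X) x) (hZ : CMDiffAt ∞ (T% Z) x) :
    CMDiffAt ∞ (koszul g Y X Z) x := by
  have h := fun {X Y : Π x : M, TangentSpace I x} (hX : CMDiffAt ∞ (T% X) x)
    (hY : CMDiffAt ∞ (T% Y) x) ↦ contMDiffAt_pairing g hX hY
  refine contMDiffAt_const.mul (((((contMDiffAt_dirDeriv hX (h hY hZ)).add
    (contMDiffAt_dirDeriv hY (h hX hZ))).sub (contMDiffAt_dirDeriv hZ (h hX hY))).add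
    (h (contMDiffAt_mlieBracket hX hY) hZ)).sub (h (contMDiffAt_mlieBracket hX hZ) hY)|>.sub
    (h (contMDiffAt_mlieBracket hY hZ) hX))

/-- A vector field is smooth once its inner products with all smooth vector fields are. -/
theorem contMDiffAt_of_pairing (g : RiemMetric I M) {W : Π x : M, TangentSpace I x} {x : M}
    (h : ∀ Z : Π x : M, TangentSpace I x, CMDiffAt ∞ (T% Z) x → CMDiffAt ∞ (pairing g W Z) x) :
    CMDiffAt ∞ (T% W) x := by
  let t := trivializationAt E (TangentSpace I : M → Type _) x
  have hx : x ∈ t.baseSet := FiberBundle.mem_baseSet_trivializationAt E (TangentSpace I) x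
  let b := Module.finBasis ℝ E
  let s := t.localFrame b
  have hs (i) : CMDiffAt ∞ (T% (s i)) x := contMDiffAt_localFrame_of_mem ∞ _ b i hx
  -- `A y` is the Gram matrix of the frame, acting on coefficient vectors. It sends the frame
  -- coefficients of `W` to the pairings of `W` with the frame, so its inverse recovers the
  -- coefficients smoothly.
  let A : M → ((Fin (Module.finrank ℝ E) → ℝ) →L[ℝ] (Fin (Module.finrank ℝ E) → ℝ)) := fun y ↦
    ∑ i, ∑ j, pairing g (s i) (s j) y •
    (ContinuousLinearMap.proj (R := ℝ) (φ := fun _ : Fin (Module.finrank ℝ E) ↦ ℝ) i).smulRight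
      (Pi.single j (1 : ℝ) : Fin (Module.finrank ℝ E) → ℝ)
  have hA : CMDiffAt ∞ A x := by
    refine contMDiffAt_finsetSum fun i _ ↦ contMDiffAt_finsetSum fun j _ ↦ ?_
    exact (contMDiffAt_pairing g (hs i) (hs j)).smul contMDiffAt_const
  have hAapp (y : M) (c : Fin (Module.finrank ℝ E) → ℝ) (j : Fin (Module.finrank ℝ E)) :
      A y c j = g.inner y (∑ i, c i • s i y) (s j y) := by
    simp [A, pairing, Finset.sum_apply, Pi.single_apply, mul_comm]
  have hinv (y : M) (hy : y ∈ t.baseSet) : (A y).IsInvertible := by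
    have hF := t.isLocalFrameOn_localFrame_baseSet I ∞ b
    have hinj : Function.Injective (A y).toLinearMap := by
      rw [injective_iff_map_eq_zero]
      intro c hc
      have h0 : ∑ i, c i • s i y = 0 := by
        -- A vector in the kernel of the Gram matrix is orthogonal to every frame field, hence to
        -- itself.
        by_contra hne
        have hp := g.pos y _ hne
        have : g.inner y (∑ i, c i • s i y) (∑ i, c i • s i y) = 0 := by
          conv_lhs => rw [map_sum]
          refine Finset.sum_eq_zero fun j _ ↦ ?_
          rw [map_smul, ← hAapp, show A y c = 0 from hc]
          simp
        exact hp.ne' this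
      exact funext (Fintype.linearIndependent_iff.1 (hF.linearIndependent hy) c h0)
    exact ⟨(LinearEquiv.ofInjectiveEndo _ hinj).toContinuousLinearEquiv, by ext; rfl⟩
  have hp : ContMDiffAt I 𝓘(ℝ, Fin (Module.finrank ℝ E) → ℝ) ∞ (fun y j ↦ pairing g W (s j) y) x :=
    contMDiffAt_pi_space.2 fun j ↦ h _ (hs j)
  have hAi : CMDiffAt ∞ (fun y ↦ (A y).inverse) x :=
    ((hinv x hx).contDiffAt_map_inverse.contMDiffAt).comp x hA
  have hc := hAi.clm_apply hp
  rw [contMDiffAt_iff_localFrameCoeff (e := t) b hx]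
  intro i
  refine (contMDiffAt_pi_space.1 hc i).congr_of_eventuallyEq ?_
  filter_upwards [t.open_baseSet.mem_nhds hx] with y hy
  have hW : (fun j : Fin (Module.finrank ℝ E) ↦ pairing g W (s j) y)
      = A y (fun i ↦ t.localFrameCoeff I b i y (W y)) := by
    ext j
    rw [hAapp, pairing, ← t.eq_sum_localFrameCoeff_smul hy]
  rw [hW, (hinv y hy).inverse_apply_self]
  rfl

/-- Koszul's formula expresses every pairing with this field through derivatives and brackets of
smooth fields. It is only available where all three fields are differentiable, hence the passage to
a neighbourhood. -/
theorem contMDiffAt_leviCivita (g : RiemMetric I M) {X Y : Π x : M, TangentSpace I x} {x : M}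
    (hX : CMDiffAt ∞ (T% X) x) (hY : CMDiffAt ∞ (T% Y) x) :
    CMDiffAt ∞ (T% (fun y ↦ leviCivita g Y y (X y))) x := by
  refine contMDiffAt_of_pairing g fun Z hZ ↦ (contMDiffAt_koszul g hY hX hZ).congr_of_eventuallyEq ?_
  filter_upwards [eventually_mdiffAt hX, eventually_mdiffAt hY, eventually_mdiffAt hZ]
    with y h1 h2 h3
  exact inner_leviCivita g h1 h2 h3

/-! ### Rules for the connection and tensoriality of the curvature. -/

theorem leviCivita_add (g : RiemMetric I M) {Y Y' : Π x : M, TangentSpace I x} {x : M}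
    (hY : MDiffAt (T% Y) x) (hY' : MDiffAt (T% Y') x) (u : TangentSpace I x) :
    leviCivita g (Y + Y') x u = leviCivita g Y x u + leviCivita g Y' x u := by
  rw [(leviCivita g).isCovariantDerivativeOnUniv.add hY hY']
  rfl

theorem leviCivita_smul (g : RiemMetric I M) {f : M → ℝ} {Y : Π x : M, TangentSpace I x} {x : M}
    (hf : MDiffAt f x) (hY : MDiffAt (T% Y) x) (u : TangentSpace I x) :
    leviCivita g (f • Y) x u = f x • leviCivita g Y x u + mvfderiv I f x u • Y x := by
  rw [(leviCivita g).isCovariantDerivativeOnUniv.leibniz hY hf]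
  rfl

theorem leviCivita_congr (g : RiemMetric I M) {Y Y' : Π x : M, TangentSpace I x} {x : M}
    (hY : MDiffAt (T% Y) x) (hY' : MDiffAt (T% Y') x) (h : ∀ᶠ y in 𝓝 x, Y y = Y' y)
    (u : TangentSpace I x) : leviCivita g Y x u = leviCivita g Y' x u := by
  rw [(leviCivita g).isCovariantDerivativeOnUniv.congr_of_eventuallyEq hY hY' Filter.univ_mem h]

/-- `X(Yf) - Y(Xf) = [X, Y] f`, multiplied by a vector field so that it can be read off from the
Jacobi identity. -/
theorem dirDeriv_commutator_smul {X Y Z : Π x : M, TangentSpace I x} {f : M → ℝ} {x : M}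
    (hX : CMDiffAt ∞ (T% X) x) (hY : CMDiffAt ∞ (T% Y) x) (hZ : CMDiffAt ∞ (T% Z) x)
    (hf : CMDiffAt ∞ f x) :
    (dirDeriv X (dirDeriv Y f) x - dirDeriv Y (dirDeriv X f) x
      - dirDeriv (mlieBracket I X Y) f x) • Z x = 0 := by
  have h2 : minSmoothness ℝ 2 ≤ ∞ := by
    rw [minSmoothness_of_isRCLikeNormedField]; exact WithTop.coe_le_coe.2 (le_top : (2 : ℕ∞) ≤ ⊤)
  have h3 : minSmoothness ℝ 3 ≤ ∞ := by
    rw [minSmoothness_of_isRCLikeNormedField]; exact WithTop.coe_le_coe.2 (le_top : (3 : ℕ∞) ≤ ⊤)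
  have : IsManifold I (minSmoothness ℝ 3) M := IsManifold.of_le (n := ∞) h3
  have hfd : MDiffAt f x := hf.mdifferentiableAt (by simp)
  have key (X Y : Π x : M, TangentSpace I x) (hX : CMDiffAt ∞ (T% X) x)
      (hY : CMDiffAt ∞ (T% Y) x) : mlieBracket I X (mlieBracket I Y (f • Z)) x
      = dirDeriv X (dirDeriv Y f) x • Z x + dirDeriv Y f x • mlieBracket I X Z x
        + dirDeriv X f x • mlieBracket I Y Z x + f x • mlieBracket I X (mlieBracket I Y Z) x := by
    have hev : mlieBracket I Y (f • Z) =ᶠ[𝓝 x] dirDeriv Y f • Z + f • mlieBracket I Y Z := by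
      filter_upwards [eventually_mdiffAt_fun hf, eventually_mdiffAt hZ] with y h1 h2
      rw [mlieBracket_smul_right h1 h2]
      rfl
    have hYf : MDiffAt (dirDeriv Y f) x := (contMDiffAt_dirDeriv hY hf).mdifferentiableAt (by simp)
    have hZd := mdiffAt_of_smooth hZ
    have hYZ := mdiffAt_of_smooth (contMDiffAt_mlieBracket hY hZ)
    rw [(Filter.EventuallyEq.refl (𝓝 x) X).mlieBracket_vectorField_eq hev,
      mlieBracket_add_right (hYf.smul_section hZd) (hfd.smul_section hYZ),
      mlieBracket_smul_right hYf hZd, mlieBracket_smul_right hfd hYZ]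
    simp only [dirDeriv]
    abel
  -- Compare the Jacobi identity for `f • Z` with `f` times the one for `Z`: the terms with a single
  -- derivative of `f` match, and only the second-order expression in `f` times `Z` survives.
  have hJ := leibniz_identity_mlieBracket_apply (hX.of_le h2) (hY.of_le h2) (hZ.of_le h2)
  have hJf := leibniz_identity_mlieBracket_apply (hX.of_le h2) (hY.of_le h2)
    ((hf.smul_section hZ).of_le h2)
  rw [key X Y hX hY, key Y X hY hX, mlieBracket_smul_right hfd (mdiffAt_of_smooth hZ), hJ] at hJf
  have h4 : dirDeriv X (dirDeriv Y f) x • Z x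
      = dirDeriv (mlieBracket I X Y) f x • Z x + dirDeriv Y (dirDeriv X f) x • Z x := by
    simp only [smul_add] at hJf
    rw [← sub_eq_zero] at hJf ⊢
    rw [← hJf]
    simp only [dirDeriv]
    abel
  rw [sub_smul, sub_smul, h4]
  abel

theorem curvature_add (g : RiemMetric I M) {X Y Z Z' : Π x : M, TangentSpace I x} {x : M}
    (hX : CMDiffAt ∞ (T% X) x) (hY : CMDiffAt ∞ (T% Y) x) (hZ : CMDiffAt ∞ (T% Z) x)
    (hZ' : CMDiffAt ∞ (T% Z') x) :
    curvature g X Y (Z + Z') x = curvature g X Y Z x + curvature g X Y Z' x := by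
  have key (X Y : Π x : M, TangentSpace I x) (hY : CMDiffAt ∞ (T% Y) x) :
      leviCivita g (fun y ↦ leviCivita g (Z + Z') y (Y y)) x (X x)
      = leviCivita g (fun y ↦ leviCivita g Z y (Y y)) x (X x)
        + leviCivita g (fun y ↦ leviCivita g Z' y (Y y)) x (X x) := by
    have h1 := contMDiffAt_leviCivita g hY hZ
    have h2 := contMDiffAt_leviCivita g hY hZ'
    have h3 := contMDiffAt_leviCivita g hY (hZ.add_section hZ')
    rw [← leviCivita_add g (mdiffAt_of_smooth h1) (mdiffAt_of_smooth h2)]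
    refine leviCivita_congr g (mdiffAt_of_smooth h3) (mdiffAt_of_smooth (h1.add_section h2)) ?_ _
    filter_upwards [eventually_mdiffAt hZ, eventually_mdiffAt hZ'] with y h1 h2
    exact leviCivita_add g h1 h2 _
  rw [curvature, key X Y hY, key Y X hX,
    leviCivita_add g (mdiffAt_of_smooth hZ) (mdiffAt_of_smooth hZ'), curvature, curvature]
  abel

/-- The first derivatives of `f` are symmetric in `X` and `Y`; the second derivatives cancel against
the bracket term by `dirDeriv_commutator_smul`. -/
theorem curvature_smul (g : RiemMetric I M) {f : M → ℝ} {X Y Z : Π x : M, TangentSpace I x} {x : M}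
    (hX : CMDiffAt ∞ (T% X) x) (hY : CMDiffAt ∞ (T% Y) x) (hZ : CMDiffAt ∞ (T% Z) x)
    (hf : CMDiffAt ∞ f x) : curvature g X Y (f • Z) x = f x • curvature g X Y Z x := by
  have hfd : MDiffAt f x := hf.mdifferentiableAt (by simp)
  have key (X Y : Π x : M, TangentSpace I x) (hY : CMDiffAt ∞ (T% Y) x) :
      leviCivita g (fun y ↦ leviCivita g (f • Z) y (Y y)) x (X x)
      = f x • leviCivita g (fun y ↦ leviCivita g Z y (Y y)) x (X x)
        + dirDeriv X f x • leviCivita g Z x (Y x) + dirDeriv Y f x • leviCivita g Z x (X x)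
        + dirDeriv X (dirDeriv Y f) x • Z x := by
    have h1 := contMDiffAt_leviCivita g hY hZ
    have h2 := contMDiffAt_dirDeriv hY hf
    have h3 := contMDiffAt_leviCivita g hY (hf.smul_section hZ)
    have h4 : leviCivita g (fun y ↦ leviCivita g (f • Z) y (Y y)) x (X x)
        = leviCivita g (f • (fun y ↦ leviCivita g Z y (Y y)) + dirDeriv Y f • Z) x (X x) := by
      refine leviCivita_congr g (mdiffAt_of_smooth h3) (mdiffAt_of_smooth
        ((hf.smul_section h1).add_section (h2.smul_section hZ))) ?_ _
      filter_upwards [eventually_mdiffAt hZ, eventually_mdiffAt_fun hf] with y h1 h2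
      exact leviCivita_smul g h2 h1 _
    rw [h4, leviCivita_add g (mdiffAt_of_smooth (hf.smul_section h1))
      (mdiffAt_of_smooth (h2.smul_section hZ)), leviCivita_smul g hfd (mdiffAt_of_smooth h1),
      leviCivita_smul g (h2.mdifferentiableAt (by simp)) (mdiffAt_of_smooth hZ)]
    simp only [dirDeriv]
    abel
  have hc := dirDeriv_commutator_smul hX hY hZ hf
  rw [curvature, key X Y hY, key Y X hX, leviCivita_smul g hfd (mdiffAt_of_smooth hZ), curvature]
  rw [sub_smul, sub_smul] at hc
  rw [← sub_eq_zero, ← hc]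
  simp only [dirDeriv, smul_sub]
  abel

theorem curvature_congr (g : RiemMetric I M) {X Y Z Z' : Π x : M, TangentSpace I x} {x : M}
    (hX : CMDiffAt ∞ (T% X) x) (hY : CMDiffAt ∞ (T% Y) x) (hZ : CMDiffAt ∞ (T% Z) x)
    (hZ' : CMDiffAt ∞ (T% Z') x) (h : ∀ᶠ y in 𝓝 x, Z y = Z' y) :
    curvature g X Y Z x = curvature g X Y Z' x := by
  have key (X Y : Π x : M, TangentSpace I x) (hY : CMDiffAt ∞ (T% Y) x) :
      leviCivita g (fun y ↦ leviCivita g Z y (Y y)) x (X x)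
      = leviCivita g (fun y ↦ leviCivita g Z' y (Y y)) x (X x) := by
    refine leviCivita_congr g (mdiffAt_of_smooth (contMDiffAt_leviCivita g hY hZ))
      (mdiffAt_of_smooth (contMDiffAt_leviCivita g hY hZ')) ?_ _
    filter_upwards [eventually_mdiffAt hZ, eventually_mdiffAt hZ', h.eventually_nhds]
      with y h1 h2 h3
    exact leviCivita_congr g h1 h2 h3 _
  rw [curvature, key X Y hY, key Y X hX,
    leviCivita_congr g (mdiffAt_of_smooth hZ) (mdiffAt_of_smooth hZ') h, curvature]

theorem curvature_sum (g : RiemMetric I M) {ι : Type*} (s : Finset ι)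
    {X Y : Π x : M, TangentSpace I x} {Z : ι → Π x : M, TangentSpace I x} {x : M}
    (hX : CMDiffAt ∞ (T% X) x) (hY : CMDiffAt ∞ (T% Y) x) (hZ : ∀ i, CMDiffAt ∞ (T% (Z i)) x) :
    curvature g X Y (fun y ↦ ∑ i ∈ s, Z i y) x = ∑ i ∈ s, curvature g X Y (Z i) x := by
  classical
  induction s using Finset.induction_on with
  | empty =>
    have h0 : CMDiffAt ∞ (T% (0 : Π x : M, TangentSpace I x)) x :=
      contMDiff_zeroSection ℝ (TangentSpace I) x
    -- The value on the zero field follows from additivity at `0 + 0`.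
    have := curvature_add g hX hY h0 h0
    simp only [add_zero, left_eq_add] at this
    exact this
  | insert a s ha h =>
    simp only [Finset.sum_insert ha, ← h]
    exact curvature_add g hX hY (hZ a) (.sum_section fun i _ ↦ hZ i)

/-- The curvature depends on its last argument only through the value at the point. -/
theorem curvature_eq_of_eq (g : RiemMetric I M) {X Y Z Z' : Π x : M, TangentSpace I x} {x : M}
    (hX : CMDiffAt ∞ (T% X) x) (hY : CMDiffAt ∞ (T% Y) x) (hZ : CMDiffAt ∞ (T% Z) x)
    (hZ' : CMDiffAt ∞ (T% Z') x) (h : Z x = Z' x) :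
    curvature g X Y Z x = curvature g X Y Z' x := by
  let t := trivializationAt E (TangentSpace I : M → Type _) x
  have hx : x ∈ t.baseSet := FiberBundle.mem_baseSet_trivializationAt E (TangentSpace I) x
  let b := Module.finBasis ℝ E
  let s := t.localFrame b
  have hs (i) : CMDiffAt ∞ (T% (s i)) x := contMDiffAt_localFrame_of_mem ∞ _ b i hx
  -- Near `x` the field is a smooth combination of a local frame, so its curvature depends only on
  -- the coefficients at `x`.
  have key {Z : Π x : M, TangentSpace I x} (hZ : CMDiffAt ∞ (T% Z) x) :
      curvature g X Y Z x = ∑ i, t.localFrameCoeff I b i x (Z x) • curvature g X Y (s i) x := by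
    have hc (i) := contMDiffAt_localFrameCoeff (e := t) b hx hZ i
    rw [curvature_congr g hX hY hZ (.sum_section fun i _ ↦ (hc i).smul_section (hs i))
      (t.eventually_eq_localFrame_sum_coeff_smul b hx)]
    refine (curvature_sum g _ hX hY fun i ↦ (hc i).smul_section (hs i)).trans ?_
    exact Finset.sum_congr rfl fun i _ ↦ curvature_smul g hX hY (hs i) (hc i)
  rw [key hZ, key hZ', h]

/-- Metric compatibility expands `V(g(X, Y))`, and torsion-freeness turns the brackets into
covariant derivatives; the derivatives along `V` cancel. -/
theorem lieDerivMetric_eq (g : RiemMetric I M) {V X Y : Π x : M, TangentSpace I x} {x : M}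
    (hV : MDiffAt (T% V) x) (hX : MDiffAt (T% X) x) (hY : MDiffAt (T% Y) x) :
    lieDerivMetric g V X Y x
      = g.inner x (leviCivita g V x (X x)) (Y x) + g.inner x (leviCivita g V x (Y x)) (X x) := by
  rw [lieDerivMetric, leviCivita_metric g hV hX hY, ← leviCivita_torsion_free g hV hX,
    ← leviCivita_torsion_free g hV hY, g.symm x (leviCivita g V x (Y x))]
  simp

/-! ### Kenmotsu identities and the deformed connection. -/

namespace AlmostContactMetric

theorem φ_ξ (S : AlmostContactMetric I M) (x : M) : S.φ x (S.ξ x) = 0 := by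
  by_contra h
  have h1 := S.g.pos x _ h
  rw [S.compat, ← S.η_eq, S.η_ξ] at h1
  simp at h1

/-- Reduces differentiability and derivatives of `η(Y)` to those of the metric. -/
theorem η_apply_eq_pairing (S : AlmostContactMetric I M) (Y : Π x : M, TangentSpace I x) :
    (fun y ↦ S.η y (Y y)) = pairing S.g S.ξ Y :=
  funext fun y ↦ S.η_eq y (Y y)

theorem mdiffAt_ξ (S : AlmostContactMetric I M) (x : M) : MDiffAt (T% S.ξ) x :=
  mdiffAt_of_smooth (S.smooth_ξ x)

theorem mdiffAt_η_apply (S : AlmostContactMetric I M) {Y : Π x : M, TangentSpace I x} {x : M}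
    (hY : MDiffAt (T% Y) x) : MDiffAt (fun y ↦ S.η y (Y y)) x := by
  rw [S.η_apply_eq_pairing]
  exact mdiffAt_pairing S.g (S.mdiffAt_ξ x) hY

theorem contMDiffAt_η_apply (S : AlmostContactMetric I M) {Y : Π x : M, TangentSpace I x} {x : M}
    (hY : CMDiffAt ∞ (T% Y) x) : CMDiffAt ∞ (fun y ↦ S.η y (Y y)) x := by
  rw [S.η_apply_eq_pairing]
  exact contMDiffAt_pairing S.g (S.smooth_ξ x) hY

theorem deform_inner (S : AlmostContactMetric I M) (a : ℝ) (ha : 0 < a) (x : M)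
    (u v : TangentSpace I x) :
    (S.deform a ha).g.inner x u v = a * S.g.inner x u v + a * (a - 1) * (S.η x u * S.η x v) := by
  simp [deform, deformMetric, etaSq]

/-- On a Kenmotsu manifold `∇_u ξ = u - η(u) ξ`. -/
theorem IsKenmotsu.leviCivita_ξ {S : AlmostContactMetric I M} (hS : S.IsKenmotsu) (x : M)
    (u : TangentSpace I x) : leviCivita S.g S.ξ x u = u - S.η x u • S.ξ x := by
  have h := hS S.ξ S.smooth_ξ x u
  have h0 : (fun y ↦ S.φ y (S.ξ y)) = (0 : Π x : M, TangentSpace I x) := funext S.φ_ξ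
  have hz : leviCivita S.g (0 : Π x : M, TangentSpace I x) x u = 0 := by simp
  rw [h0, hz, S.g.symm x (S.φ x u), ← S.η_eq, S.η_φ, S.η_ξ] at h
  have h1 : S.φ x (leviCivita S.g S.ξ x u) = S.φ x u := by simpa using h
  -- `ξ` has constant length, so its covariant derivative is orthogonal to it.
  have hη : S.η x (leviCivita S.g S.ξ x u) = 0 := by
    have hu := mdifferentiableAt_extend I E u
    have hm := leviCivita_metric S.g hu (S.mdiffAt_ξ x) (S.mdiffAt_ξ x)
    have hc : pairing S.g S.ξ S.ξ = fun _ ↦ 1 := by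
      rw [← S.η_apply_eq_pairing]
      exact funext S.η_ξ
    rw [hc, S.g.symm x (leviCivita S.g S.ξ x _), ← S.η_eq] at hm
    rw [dirDeriv, mvfderiv_const] at hm
    simp only [extend_apply_self, zero_apply] at hm
    linarith
  -- `φ` is injective on the kernel of `η`; applying it again inverts it there through `φ² = -I + η
  -- ⊗ ξ`.
  have h2 := congrArg (S.φ x) h1
  rw [S.φ_sq, S.φ_sq, hη] at h2
  rw [zero_smul, add_zero] at h2
  rw [← neg_inj, h2]
  abel

/-- Differentiate `g(ξ, Y)` using `∇_u ξ = u - η(u) ξ`. The part not involving `∇Y` is symmetric in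
`u` and `Y`, which encodes that `η` is closed. -/
theorem IsKenmotsu.mvfderiv_η_apply {S : AlmostContactMetric I M} (hS : S.IsKenmotsu)
    {Y : Π x : M, TangentSpace I x} {x : M} (hY : MDiffAt (T% Y) x) (u : TangentSpace I x) :
    mvfderiv I (fun y ↦ S.η y (Y y)) x u
      = S.g.inner x u (Y x) - S.η x u * S.η x (Y x) + S.η x (leviCivita S.g Y x u) := by
  have hm := leviCivita_metric S.g (mdifferentiableAt_extend I E u) (S.mdiffAt_ξ x) hY
  simp only [dirDeriv, extend_apply_self] at hm
  rw [S.η_apply_eq_pairing, hm, hS.leviCivita_ξ, S.η_eq x (leviCivita S.g Y x u),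
    S.η_eq x (Y x)]
  simp

theorem IsKenmotsu.dirDeriv_ξ_η {S : AlmostContactMetric I M} (hS : S.IsKenmotsu)
    {V : Π x : M, TangentSpace I x} {x : M} (hV : MDiffAt (T% V) x) :
    dirDeriv S.ξ (fun y ↦ S.η y (V y)) x = S.η x (leviCivita S.g V x (S.ξ x)) := by
  rw [dirDeriv, hS.mvfderiv_η_apply hV, ← S.η_eq, S.η_ξ]
  ring

/-- The Levi-Civita connection of the deformed metric. -/
theorem IsKenmotsu.leviCivita_deform {S : AlmostContactMetric I M} (hS : S.IsKenmotsu)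
    {a : ℝ} (ha : 0 < a) {Y : Π x : M, TangentSpace I x} {x : M} (hY : MDiffAt (T% Y) x)
    (u : TangentSpace I x) :
    leviCivita (S.deform a ha).g Y x u = leviCivita S.g Y x u
      + ((1 - 1 / a) * (S.g.inner x u (Y x) - S.η x u * S.η x (Y x))) • S.ξ x := by
  refine inner_ext (S.deform a ha).g fun w ↦ ?_
  have hu := mdifferentiableAt_extend I E u
  have hw := mdifferentiableAt_extend I E w
  have h1 := inner_leviCivita (S.deform a ha).g hu hY hw
  have h2 := inner_leviCivita S.g hu hY hw
  have hd {X Y Z : Π x : M, TangentSpace I x} (hX : MDiffAt (T% X) x) (hY : MDiffAt (T% Y) x) :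
      dirDeriv Z (pairing (S.deform a ha).g X Y) x = a * dirDeriv Z (pairing S.g X Y) x
        + a * (a - 1) * (S.η x (X x) * dirDeriv Z (fun y ↦ S.η y (Y y)) x
          + S.η x (Y x) * dirDeriv Z (fun y ↦ S.η y (X y)) x) := by
    have hXη := S.mdiffAt_η_apply hX
    have hYη := S.mdiffAt_η_apply hY
    have he : pairing (S.deform a ha).g X Y = (fun _ ↦ a) * pairing S.g X Y
        + (fun _ ↦ a * (a - 1)) * ((fun y ↦ S.η y (X y)) * (fun y ↦ S.η y (Y y))) :=
      funext fun y ↦ S.deform_inner a ha y _ _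
    have hc (r : ℝ) : MDiffAt (fun _ : M ↦ r) x := mdifferentiableAt_const
    have hc0 (r : ℝ) : dirDeriv Z (fun _ : M ↦ r) x = 0 := by
      rw [dirDeriv, mvfderiv_const]; rfl
    rw [he, dirDeriv_add _ ((hc _).mul (mdiffAt_pairing S.g hX hY)) ((hc _).mul (hXη.mul hYη)),
      dirDeriv_mul _ (hc _) (mdiffAt_pairing S.g hX hY), dirDeriv_mul _ (hc _) (hXη.mul hYη),
      dirDeriv_mul _ hXη hYη, hc0, hc0]
    ring
  -- Writing `η` of each bracket through `∇` puts both Koszul formulas in the same terms, and the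
  -- derivatives of the auxiliary extensions then cancel.
  have t1 := congrArg (S.η x) (leviCivita_torsion_free S.g hu hY)
  have t2 := congrArg (S.η x) (leviCivita_torsion_free S.g hu hw)
  have t3 := congrArg (S.η x) (leviCivita_torsion_free S.g hY hw)
  rw [koszul, hd hY hw, hd hu hw, hd hu hY] at h1
  rw [koszul] at h2
  have hη {Y Z : Π x : M, TangentSpace I x} (hY : MDiffAt (T% Y) x) :
      dirDeriv Z (fun y ↦ S.η y (Y y)) x = S.g.inner x (Z x) (Y x) - S.η x (Z x) * S.η x (Y x)
        + S.η x (leviCivita S.g Y x (Z x)) := hS.mvfderiv_η_apply hY (Z x)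
  simp only [S.deform_inner, ← t1, ← t2, ← t3, hη hY, hη hu, hη hw, extend_apply_self,
    map_sub] at h1 h2
  rw [S.g.symm x (Y x) u, S.g.symm x w u, S.g.symm x w (Y x)] at h1
  simp only [S.deform_inner, map_add, map_smul, add_apply, smul_apply, smul_eq_mul, S.η_ξ,
    ← S.η_eq]
  -- Since `ḡ(ξ, w) = a² η(w)`, the correction along `ξ` contributes `a² (1 - 1/a) = a (a - 1)`.
  have ha' : a * (1 - 1 / a) = a - 1 := by field_simp
  linear_combination h1 - a * h2 - a * (S.g.inner x u (Y x) - S.η x u * S.η x (Y x)) * S.η x w * ha'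

end AlmostContactMetric

/-! ### Curvature and Ricci tensor under the deformation. -/

theorem sum_repr_mul_apply {ι V : Type*} [Fintype ι] [AddCommGroup V] [Module ℝ V]
    (b : Module.Basis ι ℝ V) (L : V →ₗ[ℝ] ℝ) (u : V) : ∑ i, b.repr u i * L (b i) = L u := by
  conv_rhs => rw [← b.sum_repr u, map_sum]
  simp

namespace AlmostContactMetric

/-- The inner derivative is `∇_Y Z + f ξ` with `f = (1 - 1/a) h(Y, Z)`. Differentiating `f ξ` yields
`df(X) ξ + f (X - η(X) ξ)`, and the outer correction ignores `f ξ` because `h(·, ξ) = 0`. -/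
theorem IsKenmotsu.leviCivita_leviCivita_deform {S : AlmostContactMetric I M} (hS : S.IsKenmotsu)
    {a : ℝ} (ha : 0 < a) {X Y Z : Π x : M, TangentSpace I x} {x : M}
    (hX : CMDiffAt ∞ (T% X) x) (hY : CMDiffAt ∞ (T% Y) x) (hZ : CMDiffAt ∞ (T% Z) x) :
    leviCivita (S.deform a ha).g (fun y ↦ leviCivita (S.deform a ha).g Z y (Y y)) x (X x)
      = leviCivita S.g (fun y ↦ leviCivita S.g Z y (Y y)) x (X x)
        + ((1 - 1 / a) * (S.g.inner x (Y x) (Z x) - S.η x (Y x) * S.η x (Z x))) •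
          (X x - S.η x (X x) • S.ξ x)
        + ((1 - 1 / a) * (S.g.inner x (X x) (leviCivita S.g Z x (Y x))
            - S.η x (X x) * S.η x (leviCivita S.g Z x (Y x))
            + S.g.inner x (leviCivita S.g Y x (X x)) (Z x)
            + S.g.inner x (Y x) (leviCivita S.g Z x (X x))
            - S.η x (Y x) * (S.g.inner x (X x) (Z x) - S.η x (X x) * S.η x (Z x)
              + S.η x (leviCivita S.g Z x (X x)))
            - S.η x (Z x) * (S.g.inner x (X x) (Y x) - S.η x (X x) * S.η x (Y x)
              + S.η x (leviCivita S.g Y x (X x))))) • S.ξ x := by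
  have hXd := mdiffAt_of_smooth hX
  have hYd := mdiffAt_of_smooth hY
  have hZd := mdiffAt_of_smooth hZ
  let f : M → ℝ := (fun _ ↦ 1 - 1 / a) *
    (pairing S.g Y Z - (fun y ↦ S.η y (Y y)) * (fun y ↦ S.η y (Z y)))
  let W : Π x : M, TangentSpace I x := fun y ↦ leviCivita S.g Z y (Y y)
  have hW : CMDiffAt ∞ (T% W) x := contMDiffAt_leviCivita S.g hY hZ
  have hf : CMDiffAt ∞ f x := contMDiffAt_const.mul ((contMDiffAt_pairing S.g hY hZ).sub
    ((S.contMDiffAt_η_apply hY).mul (S.contMDiffAt_η_apply hZ)))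
  have hF : CMDiffAt ∞ (T% (f • S.ξ)) x := hf.smul_section (S.smooth_ξ x)
  have hWF := hW.add_section hF
  have hfd : MDiffAt f x := hf.mdifferentiableAt (by simp)
  have hdf : mvfderiv I f x (X x) = (1 - 1 / a) * (
      S.g.inner x (leviCivita S.g Y x (X x)) (Z x) + S.g.inner x (Y x) (leviCivita S.g Z x (X x))
      - (S.η x (Y x) * (S.g.inner x (X x) (Z x) - S.η x (X x) * S.η x (Z x)
              + S.η x (leviCivita S.g Z x (X x)))
        + S.η x (Z x) * (S.g.inner x (X x) (Y x) - S.η x (X x) * S.η x (Y x)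
              + S.η x (leviCivita S.g Y x (X x))))) := by
    have h1 := mdiffAt_pairing S.g hYd hZd
    have h2 := S.mdiffAt_η_apply hYd
    have h3 := S.mdiffAt_η_apply hZd
    have h4 := leviCivita_metric S.g hXd hYd hZd
    rw [dirDeriv] at h4
    rw [mvfderiv_mul mdifferentiableAt_const (h1.sub (h2.mul h3)), mvfderiv_sub h1 (h2.mul h3),
      mvfderiv_mul h2 h3, mvfderiv_const]
    simp only [add_apply, smul_apply, sub_apply, smul_eq_mul, smul_zero, add_zero, h4,
      hS.mvfderiv_η_apply hYd, hS.mvfderiv_η_apply hZd]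
  rw [leviCivita_congr (Y' := W + f • S.ξ) _
    (mdiffAt_of_smooth (contMDiffAt_leviCivita _ hY hZ)) (mdiffAt_of_smooth hWF)
    ((eventually_mdiffAt hZ).mono fun y hy ↦ hS.leviCivita_deform ha hy (Y y)),
    hS.leviCivita_deform ha (mdiffAt_of_smooth hWF),
    leviCivita_add S.g (mdiffAt_of_smooth hW) (mdiffAt_of_smooth hF),
    leviCivita_smul S.g hfd (S.mdiffAt_ξ x), hdf, hS.leviCivita_ξ]
  have hv : (W + f • S.ξ) x = leviCivita S.g Z x (Y x) + ((1 - 1 / a) *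
    (S.g.inner x (Y x) (Z x) - S.η x (Y x) * S.η x (Z x))) • S.ξ x := rfl
  have hfx : f x = (1 - 1 / a) *
    (S.g.inner x (Y x) (Z x) - S.η x (Y x) * S.η x (Z x)) := rfl
  simp only [hv, hfx, map_add, map_smul, S.η_ξ, smul_eq_mul, S.g.symm x (X x) (S.ξ x), ← S.η_eq]
  module

/-- The curvature of the deformed metric. -/
theorem IsKenmotsu.curvature_deform {S : AlmostContactMetric I M} (hS : S.IsKenmotsu)
    {a : ℝ} (ha : 0 < a) {X Y Z : Π x : M, TangentSpace I x} {x : M}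
    (hX : CMDiffAt ∞ (T% X) x) (hY : CMDiffAt ∞ (T% Y) x) (hZ : CMDiffAt ∞ (T% Z) x) :
    curvature (S.deform a ha).g X Y Z x = curvature S.g X Y Z x
      + (1 - 1 / a) • ((S.g.inner x (Y x) (Z x) - S.η x (Y x) * S.η x (Z x)) • X x
        - (S.g.inner x (X x) (Z x) - S.η x (X x) * S.η x (Z x)) • Y x) := by
  -- The terms with derivatives of `X` and `Y` assemble into `h([X, Y], Z) ξ` and cancel the
  -- correction in the bracket term.
  have ht := leviCivita_torsion_free S.g (mdiffAt_of_smooth hX) (mdiffAt_of_smooth hY)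
  have hg : S.g.inner x (mlieBracket I X Y x) (Z x)
      = S.g.inner x (leviCivita S.g Y x (X x)) (Z x)
        - S.g.inner x (leviCivita S.g X x (Y x)) (Z x) := by
    rw [← ht]; simp
  have hη : S.η x (mlieBracket I X Y x)
      = S.η x (leviCivita S.g Y x (X x)) - S.η x (leviCivita S.g X x (Y x)) := by
    rw [← ht]; simp
  rw [curvature, hS.leviCivita_leviCivita_deform ha hX hY hZ,
    hS.leviCivita_leviCivita_deform ha hY hX hZ, hS.leviCivita_deform ha (mdiffAt_of_smooth hZ),
    hg, hη, curvature, S.g.symm x (Y x) (X x)]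
  module

/-- The Ricci tensor of the deformed metric. -/
theorem IsKenmotsu.ricci_deform {S : AlmostContactMetric I M} (hS : S.IsKenmotsu)
    {a : ℝ} (ha : 0 < a) (x : M) (u v : TangentSpace I x) :
    ricci (S.deform a ha).g x u v = ricci S.g x u v
      + (Module.finrank ℝ E - 1) * (1 - 1 / a) * (S.g.inner x u v - S.η x u * S.η x v) := by
  let b := Module.finBasis ℝ (TangentSpace I x)
  have hsm (w : TangentSpace I x) : CMDiffAt ∞ (T% (extend E w)) x := contMDiffAt_extend I E w
  -- In the trace, `h(u, v)` times the identity contributes the dimension and the rank-one term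
  -- contributes `-h(u, v)`, whence the factor `dim - 1`.
  have hu : (∑ i, b.repr u i * (S.g.inner x (b i) v - S.η x (b i) * S.η x v))
      = S.g.inner x u v - S.η x u * S.η x v := by
    simpa [metricForm, mul_comm] using sum_repr_mul_apply b
      ((metricForm S.g x).flip v - S.η x v • (S.η x).toLinearMap) u
  have hsum : ∑ i, b.coord i ((1 - 1 / a) • ((S.g.inner x u v - S.η x u * S.η x v) • b i
        - (S.g.inner x (b i) v - S.η x (b i) * S.η x v) • u))
      = (1 - 1 / a) * (Module.finrank ℝ E * (S.g.inner x u v - S.η x u * S.η x v)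
        - ∑ i, b.repr u i * (S.g.inner x (b i) v - S.η x (b i) * S.η x v)) := by
    have hcoord (i) : b.coord i ((1 - 1 / a) • ((S.g.inner x u v - S.η x u * S.η x v) • b i
        - (S.g.inner x (b i) v - S.η x (b i) * S.η x v) • u))
        = (1 - 1 / a) * ((S.g.inner x u v - S.η x u * S.η x v)
          - b.repr u i * (S.g.inner x (b i) v - S.η x (b i) * S.η x v)) := by
      simp only [map_smul, map_sub, Module.Basis.coord_apply, Module.Basis.repr_self,
        Finsupp.single_eq_same, smul_eq_mul]
      ring
    simp only [hcoord]
    rw [← Finset.mul_sum, Finset.sum_sub_distrib, Finset.sum_const, Finset.card_univ,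
      Fintype.card_fin, nsmul_eq_mul]
    rfl
  have h : ricci (S.deform a ha).g x u v = ricci S.g x u v
      + ∑ i, b.coord i ((1 - 1 / a) • ((S.g.inner x u v - S.η x u * S.η x v) • b i
        - (S.g.inner x (b i) v - S.η x (b i) * S.η x v) • u)) := by
    rw [ricci, ricci, ← Finset.sum_add_distrib]
    refine Finset.sum_congr rfl fun i _ ↦ ?_
    rw [hS.curvature_deform ha (hsm _) (hsm _) (hsm _), map_add]
    simp only [extend_apply_self]
    rfl
  rw [h, hsum, hu]
  ring

/-- Differentiate `∇_Y ξ = Y - η(Y) ξ` and antisymmetrize. The result is the expression for constant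
curvature `-1`, here only with last argument `ξ`. -/
theorem IsKenmotsu.curvature_ξ {S : AlmostContactMetric I M} (hS : S.IsKenmotsu)
    {X Y : Π x : M, TangentSpace I x} {x : M}
    (hX : CMDiffAt ∞ (T% X) x) (hY : CMDiffAt ∞ (T% Y) x) :
    curvature S.g X Y S.ξ x = S.η x (X x) • Y x - S.η x (Y x) • X x := by
  have key {X Y : Π x : M, TangentSpace I x}
      (hY : CMDiffAt ∞ (T% Y) x) :
      leviCivita S.g (fun y ↦ leviCivita S.g S.ξ y (Y y)) x (X x)
        = leviCivita S.g Y x (X x) - S.η x (Y x) • (X x - S.η x (X x) • S.ξ x)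
          - (S.g.inner x (X x) (Y x) - S.η x (X x) * S.η x (Y x)
            + S.η x (leviCivita S.g Y x (X x))) • S.ξ x := by
    have hYd := mdiffAt_of_smooth hY
    have hηY : MDiffAt (-(fun y ↦ S.η y (Y y))) x := (S.mdiffAt_η_apply hYd).neg
    have he : (fun y ↦ leviCivita S.g S.ξ y (Y y)) = Y + (-(fun y ↦ S.η y (Y y))) • S.ξ := by
      ext1 y
      rw [hS.leviCivita_ξ]
      simp [sub_eq_add_neg]
    rw [he, leviCivita_add S.g hYd (hηY.smul_section (S.mdiffAt_ξ x)),
      leviCivita_smul S.g hηY (S.mdiffAt_ξ x), mvfderiv_neg, hS.leviCivita_ξ]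
    simp only [neg_apply, hS.mvfderiv_η_apply hYd, Pi.neg_apply]
    module
  have ht := leviCivita_torsion_free S.g (mdiffAt_of_smooth hX) (mdiffAt_of_smooth hY)
  rw [curvature, key hY, key hX, hS.leviCivita_ξ, ← ht, map_sub, S.g.symm x (Y x) (X x)]
  module

/-- This is the trace of `w ↦ η(w) ξ - w`. -/
theorem IsKenmotsu.ricci_ξ_ξ {S : AlmostContactMetric I M} (hS : S.IsKenmotsu) (x : M) :
    ricci S.g x (S.ξ x) (S.ξ x) = 1 - Module.finrank ℝ E := by
  let b := Module.finBasis ℝ (TangentSpace I x)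
  have hsm (w : TangentSpace I x) : CMDiffAt ∞ (T% (extend E w)) x := contMDiffAt_extend I E w
  have hfr : Module.finrank ℝ (TangentSpace I x) = Module.finrank ℝ E := rfl
  have hξ : ∑ i, b.repr (S.ξ x) i * S.η x (b i) = 1 := by
    rw [← S.η_ξ x]
    exact sum_repr_mul_apply b (S.η x).toLinearMap (S.ξ x)
  have h : ricci S.g x (S.ξ x) (S.ξ x)
      = ∑ i, b.coord i (S.η x (b i) • S.ξ x - (1 : ℝ) • b i) := by
    refine Finset.sum_congr rfl fun i _ ↦ ?_
    -- The arbitrary extension of the vector `ξ x` is replaced by the field `ξ`, whose covariant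
    -- derivative is known.
    rw [curvature_eq_of_eq S.g (hsm _) (hsm _) (hsm _) (S.smooth_ξ x) (extend_apply_self ..),
      hS.curvature_ξ (hsm _) (hsm _)]
    simp only [extend_apply_self, S.η_ξ]
    rfl
  rw [h]
  simp only [map_smul, map_sub, Module.Basis.coord_apply, Module.Basis.repr_self,
    Finsupp.single_eq_same, smul_eq_mul, mul_one, Finset.sum_sub_distrib,
    Finset.sum_const, Finset.card_univ, Fintype.card_fin, hfr, nsmul_eq_mul]
  rw [← hξ]
  congr 1
  exact Finset.sum_congr rfl fun i _ ↦ mul_comm _ _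

end AlmostContactMetric

/-! ### Traces, divergence and the soliton equation. -/

theorem sum_inner_onb_mul_apply (g : RiemMetric I M) (x : M) (u : TangentSpace I x)
    (L : TangentSpace I x →ₗ[ℝ] ℝ) : ∑ i, g.inner x u (onb g x i) * L (onb g x i) = L u := by
  let _ : RiemannianBundle (TangentSpace I : M → Type _) := ⟨g.toRiemannianMetric⟩
  have h := (stdOrthonormalBasis ℝ (TangentSpace I x)).sum_repr' u
  conv_rhs => rw [← h, map_sum]
  refine Finset.sum_congr rfl fun i _ ↦ ?_
  rw [map_smul, g.symm x u]
  rfl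

theorem sum_inner_apply_onb (g : RiemMetric I M) (x : M)
    (T : TangentSpace I x →ₗ[ℝ] TangentSpace I x) :
    ∑ i, g.inner x (T (onb g x i)) (onb g x i) = LinearMap.trace ℝ (TangentSpace I x) T := by
  let _ : RiemannianBundle (TangentSpace I : M → Type _) := ⟨g.toRiemannianMetric⟩
  rw [LinearMap.trace_eq_sum_inner T (stdOrthonormalBasis ℝ (TangentSpace I x))]
  exact Finset.sum_congr rfl fun i _ ↦ g.symm x _ _

namespace AlmostContactMetric

/-- The connection changes by the rank-one endomorphism `u ↦ (1 - 1/a) h(u, V) ξ`, whose trace is a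
multiple of `h(ξ, V) = 0`. -/
theorem IsKenmotsu.divergence_deform {S : AlmostContactMetric I M} (hS : S.IsKenmotsu)
    {a : ℝ} (ha : 0 < a) {V : Π x : M, TangentSpace I x} {x : M} (hV : MDiffAt (T% V) x) :
    divergence (S.deform a ha).g V x = divergence S.g V x := by
  have h : (leviCivita (S.deform a ha).g V x : TangentSpace I x →ₗ[ℝ] TangentSpace I x)
      = leviCivita S.g V x + ((1 - 1 / a) • ((metricForm S.g x).flip (V x)
        - S.η x (V x) • (S.η x).toLinearMap)).smulRight (S.ξ x) := by
    ext u
    have := hS.leviCivita_deform ha hV u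
    simpa [metricForm, mul_comm (S.η x u)] using this
  have h0 : S.g.inner x (S.ξ x) (V x) = S.η x (V x) := (S.η_eq x _).symm
  rw [divergence, h, map_add, LinearMap.trace_smulRight, divergence]
  simp [metricForm, h0, S.η_ξ]

theorem IsKenmotsu.half_lieDerivMetric_deform {S : AlmostContactMetric I M} (hS : S.IsKenmotsu)
    {a : ℝ} (ha : 0 < a) {V X Y : Π x : M, TangentSpace I x} {x : M}
    (hV : MDiffAt (T% V) x) (hX : MDiffAt (T% X) x) (hY : MDiffAt (T% Y) x) :
    (1 / 2) * lieDerivMetric (S.deform a ha).g V X Y x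
      = a / 2 * (S.g.inner x (leviCivita S.g V x (X x)) (Y x)
          + S.g.inner x (leviCivita S.g V x (Y x)) (X x))
        + a * (a - 1) / 2 *
          (S.η x (X x) * (S.η x (leviCivita S.g V x (Y x)) + S.g.inner x (Y x) (V x))
            + S.η x (Y x) * (S.η x (leviCivita S.g V x (X x)) + S.g.inner x (X x) (V x))
            - 2 * S.η x (X x) * S.η x (Y x) * S.η x (V x)) := by
  rw [lieDerivMetric_eq _ hV hX hY, hS.leviCivita_deform ha hV, hS.leviCivita_deform ha hV]
  simp only [S.deform_inner, map_add, map_smul, add_apply, smul_apply, smul_eq_mul, ← S.η_eq,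
    S.η_ξ]
  have ha' : a * (1 - 1 / a) = a - 1 := by field_simp
  linear_combination (a / 2 * ((S.g.inner x (X x) (V x) - S.η x (X x) * S.η x (V x)) * S.η x (Y x)
    + (S.g.inner x (Y x) (V x) - S.η x (Y x) * S.η x (V x)) * S.η x (X x))) * ha'

variable {S : AlmostContactMetric I M} {a : ℝ} {ha : 0 < a} {V : Π x : M, TangentSpace I x}
  {lam : M → ℝ}

/-- At `(ξ, ξ)` the Ricci correction vanishes, the Lie derivative term is `a² ξ(η(V))` and `ḡ(ξ, ξ)
= a²`; divide by `a²`. -/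
theorem IsKenmotsu.soliton_function_eq (hS : S.IsKenmotsu)
    (hsol : IsAlmostRicciSoliton (S.deform a ha).g V lam) (x : M) :
    lam x = dirDeriv S.ξ (fun y ↦ S.η y (V y)) x - (Module.finrank ℝ E - 1) / a ^ 2 := by
  have hV := mdiffAt_of_smooth (hsol.smooth_field x)
  have h := hsol.equation x S.ξ S.ξ (S.smooth_ξ x) (S.smooth_ξ x)
  rw [hS.half_lieDerivMetric_deform ha hV (S.mdiffAt_ξ x) (S.mdiffAt_ξ x), hS.ricci_deform,
    hS.ricci_ξ_ξ, S.deform_inner, S.g.symm x _ (S.ξ x)] at h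
  simp only [← S.η_eq, S.η_ξ] at h
  rw [hS.dirDeriv_ξ_η hV]
  field_simp
  linear_combination -h

/-- Solve the soliton equation for `Ric`. The constants from the soliton function and from the Ricci
correction combine through `a⁻² ḡ + (1 - 1/a) h = g`, so they leave no `η ⊗ η` term. -/
theorem IsKenmotsu.ricci_eq_of_soliton (hS : S.IsKenmotsu)
    (hsol : IsAlmostRicciSoliton (S.deform a ha).g V lam) (x : M) (X Y : TangentSpace I x) :
    ricci S.g x X Y =
      (a * dirDeriv S.ξ (fun y ↦ S.η y (V y)) x - (Module.finrank ℝ E - 1)) * S.g.inner x X Y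
      + a * (a - 1) * dirDeriv S.ξ (fun y ↦ S.η y (V y)) x * S.η x X * S.η x Y
      - a / 2 * (S.g.inner x (leviCivita S.g V x X) Y + S.g.inner x (leviCivita S.g V x Y) X)
      - a * (a - 1) / 2 *
        (S.η x X * (S.η x (leviCivita S.g V x Y) + S.g.inner x Y (V x))
          + S.η x Y * (S.η x (leviCivita S.g V x X) + S.g.inner x X (V x))
          - 2 * S.η x X * S.η x Y * S.η x (V x)) := by
  have hV := mdiffAt_of_smooth (hsol.smooth_field x)
  have h := hsol.equation x (extend E X) (extend E Y) (contMDiffAt_extend I E X)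
    (contMDiffAt_extend I E Y)
  rw [hS.half_lieDerivMetric_deform ha hV (mdifferentiableAt_extend I E X)
    (mdifferentiableAt_extend I E Y), hS.ricci_deform, S.deform_inner,
    hS.soliton_function_eq hsol] at h
  simp only [extend_apply_self] at h
  have ha0 := ha.ne'
  field_simp at h
  refine mul_left_cancel₀ ha0 ?_
  linear_combination h / 2

theorem IsKenmotsu.scal_eq_of_solenoidal_soliton (hS : S.IsKenmotsu)
    (hsol : IsAlmostRicciSoliton (S.deform a ha).g V lam) (x : M)
    (hdiv : divergence (S.deform a ha).g V x = 0) :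
    scal S.g x = Module.finrank ℝ E *
      (a * dirDeriv S.ξ (fun y ↦ S.η y (V y)) x - (Module.finrank ℝ E - 1)) := by
  have hV := mdiffAt_of_smooth (hsol.smooth_field x)
  rw [hS.divergence_deform ha hV] at hdiv
  have htr := sum_inner_apply_onb S.g x (leviCivita S.g V x).toLinearMap
  -- `ξ` is the metric dual of `η`, so contracting `η` with a form evaluates the form at `ξ`.
  have hη (L : TangentSpace I x →ₗ[ℝ] ℝ) :
      ∑ i, S.η x (onb S.g x i) * L (onb S.g x i) = L (S.ξ x) := by
    simp only [S.η_eq]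
    exact sum_inner_onb_mul_apply S.g x (S.ξ x) L
  have h1 := hη (S.η x).toLinearMap
  have h2 := hη ((S.η x).toLinearMap ∘ₗ (leviCivita S.g V x).toLinearMap)
  have h3 : ∑ i, S.η x (onb S.g x i) * S.g.inner x (onb S.g x i) (V x) = S.η x (V x) := by
    rw [S.η_eq x (V x)]
    exact hη ((metricForm S.g x).flip (V x))
  have h0 : ∑ i, S.g.inner x (onb S.g x i) (onb S.g x i) = Module.finrank ℝ E := by
    simp only [inner_onb, if_true, Finset.sum_const, Finset.card_univ, Fintype.card_fin,
      nsmul_eq_mul, mul_one]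
    rfl
  simp only [LinearMap.coe_comp, Function.comp_apply, ContinuousLinearMap.coe_coe,
    S.η_ξ] at htr h1 h2
  rw [divergence] at hdiv
  rw [hdiv] at htr
  rw [← hS.dirDeriv_ξ_η hV] at h2
  set D := dirDeriv S.ξ (fun y ↦ S.η y (V y)) x
  -- On the diagonal the two symmetric halves coincide. After contraction the `η(V)` terms cancel,
  -- and so do the `a (a - 1) ξ(η(V))` terms.
  have hsum : scal S.g x = (a * D - (Module.finrank ℝ E - 1))
        * ∑ i, S.g.inner x (onb S.g x i) (onb S.g x i)
      + (a * (a - 1) * (D + S.η x (V x))) * ∑ i, S.η x (onb S.g x i) * S.η x (onb S.g x i)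
      - a * ∑ i, S.g.inner x (leviCivita S.g V x (onb S.g x i)) (onb S.g x i)
      - a * (a - 1) * ∑ i, S.η x (onb S.g x i) * S.η x (leviCivita S.g V x (onb S.g x i))
      - a * (a - 1) * ∑ i, S.η x (onb S.g x i) * S.g.inner x (onb S.g x i) (V x) := by
    simp only [Finset.mul_sum, ← Finset.sum_add_distrib, ← Finset.sum_sub_distrib]
    refine Finset.sum_congr rfl fun i _ ↦ ?_
    rw [hS.ricci_eq_of_soliton hsol]
    ring
  rw [hsum, h0, h1, h2, h3, htr]
  ring

end AlmostContactMetric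

end AlmostContact

theorem mainTheorem4 (n : ℕ) {M : Type*} [TopologicalSpace M] [T2Space M]
    [SecondCountableTopology M] [ChartedSpace (EuclideanSpace ℝ (Fin (2 * n + 1))) M]
    [IsManifold (𝓡 (2 * n + 1)) ∞ M]
    (S : AlmostContactMetric (𝓡 (2 * n + 1)) M) (hS : S.IsKenmotsu)
    (a : ℝ) (ha : 0 < a)
    (V : Π x : M, TangentSpace (𝓡 (2 * n + 1)) x) (lam : M → ℝ)
    (hsol : IsAlmostRicciSoliton (S.deform a ha).g V lam)
    (hdiv : ∀ x : M, divergence (S.deform a ha).g V x = 0) :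
    (∀ x : M, lam x = dirDeriv S.ξ (fun y ↦ S.η y (V y)) x - 2 * n / a ^ 2) ∧
    (∀ (x : M) (X Y : TangentSpace (𝓡 (2 * n + 1)) x),
      ricci S.g x X Y =
        (a * dirDeriv S.ξ (fun y ↦ S.η y (V y)) x - 2 * n) * S.g.inner x X Y
        + a * (a - 1) * dirDeriv S.ξ (fun y ↦ S.η y (V y)) x * S.η x X * S.η x Y
        - a / 2 * (S.g.inner x (leviCivita S.g V x X) Y + S.g.inner x (leviCivita S.g V x Y) X)
        - a * (a - 1) / 2 *
          (S.η x X * (S.η x (leviCivita S.g V x Y) + S.g.inner x Y (V x))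
            + S.η x Y * (S.η x (leviCivita S.g V x X) + S.g.inner x X (V x))
            - 2 * S.η x X * S.η x Y * S.η x (V x))) ∧
    (∀ x : M, scal S.g x =
      (2 * n + 1) * (a * dirDeriv S.ξ (fun y ↦ S.η y (V y)) x - 2 * n)) := by
  have hfr : (Module.finrank ℝ (EuclideanSpace ℝ (Fin (2 * n + 1))) : ℝ) = 2 * n + 1 := by simp
  have hfr' : (Module.finrank ℝ (EuclideanSpace ℝ (Fin (2 * n + 1))) : ℝ) - 1 = 2 * n := by
    rw [hfr]; ring
  refine ⟨fun x ↦ ?_, fun x X Y ↦ ?_, fun x ↦ ?_⟩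
  · rw [hS.soliton_function_eq hsol x, hfr']
  · rw [hS.ricci_eq_of_soliton hsol x X Y, hfr']
  · rw [hS.scal_eq_of_solenoidal_soliton hsol x (hdiv x), hfr', hfr]
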